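/- All rings are commutative with $1$. For a ring $A$ let $\operatorname{Tot}(A)$ be its total ring of fractions. An ideal is regular if it contains a non-zero-divisor; an ideal $I$ of $A$ is invertible if $IJ=A$ for some $A$-submodule $J\subseteq\operatorname{Tot}(A)$; and $A$ is a Prüfer ring if every finitely generated regular ideal of $A$ is invertible. A pair $(A,\mathfrak p)$ is a Manis pair if $\mathfrak p$ is a prime ideal of $A$ and for every $x\in\operatorname{Tot}(A)\setminus A$ there is $y\in\mathfrak p$ with $xy\in A\setminus\mathfrak p$. A Prüfer Manis ring is a Prüfer ring $A$ that has a unique regular maximal ideal $\mathfrak m$. Proposition (Prüfer Manis rings). Let $B$ be a Prüfer Manis ring with unique regular maximal ideal $\mathfrak m$, let $\pi:B\to B/\mathfrak m$ be the canonical projection, and let $V\subseteq B/\mathfrak m$ be a valuation domain whose quotient field is $B/\mathfrak m$. Then the subring $A:=\pi^{-1}(V)$ of $B$ is a Prüfer Manis ring; moreover, if $\mathfrak p$ is its unique regular maximal ideal, then $(A,\mathfrak p)$ is a Manis pair. -/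

import Mathlib

open scoped nonZeroDivisors

/-- An ideal of a commutative ring is regular if it contains a regular element (a non-zero-divisor).
-/
def IsRegularIdeal {A : Type*} [CommRing A] (I : Ideal A) : Prop :=
  ∃ a ∈ I, a ∈ A⁰

/-- An ideal `I` of `A` is invertible if `I * J = A` for some `A`-submodule `J` of the total ring of
fractions `Tot(A) = FractionRing A`. -/
def IsInvertibleIdeal {A : Type*} [CommRing A] (I : Ideal A) : Prop :=
  ∃ J : Submodule A (FractionRing A),
    IsLocalization.coeSubmodule (FractionRing A) I * J = 1

/-- A Prüfer ring: every finitely generated regular ideal is invertible. -/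
def IsPruferRing (A : Type*) [CommRing A] : Prop :=
  ∀ I : Ideal A, I.FG → IsRegularIdeal I → IsInvertibleIdeal I

/-- A Manis pair `(A, p)`: the ideal `p` is prime and for every `x ∈ Tot(A) \ A` there is `y ∈ p`
with `x * y ∈ A \ p`. -/
structure IsManisPair (A : Type*) [CommRing A] (p : Ideal A) : Prop where
  isPrime : p.IsPrime
  exists_mul_eq : ∀ x : FractionRing A, x ∉ Set.range (algebraMap A (FractionRing A)) →
    ∃ y ∈ p, ∃ z : A, z ∉ p ∧ x * algebraMap A (FractionRing A) y = algebraMap A (FractionRing A) z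

/-- `m` is the unique regular maximal ideal of `A`. -/
structure IsUniqueRegularMaximal {A : Type*} [CommRing A] (m : Ideal A) : Prop where
  isMaximal : m.IsMaximal
  isRegular : IsRegularIdeal m
  eq_of_isMaximal : ∀ n : Ideal A, n.IsMaximal → IsRegularIdeal n → n = m

/-- A Prüfer Manis ring `A` with ideal `m`: a Prüfer ring whose unique regular maximal ideal is `m`.
(In particular `(A, m)` is then a Manis pair.) -/
structure IsPruferManisRing (A : Type*) [CommRing A] (m : Ideal A) : Prop where
  isPrufer : IsPruferRing A
  isUniqueRegularMaximal : IsUniqueRegularMaximal m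

/-! Since `m` lies in `A` and contains a non-zero-divisor of `B`, fractions over `A` are fractions
over `B`. Let `p` be the preimage in `A` of the maximal ideal of `V`. The Manis property of `B`
reduces that of `A` to fractions lying in `B`, where the valuation property of `V` decides. Every
regular ideal of `A` not inside `p` is `A`; with the Manis property this yields Prüfer
(`IsManisPair.isPruferRing`). -/

theorem IsRegularIdeal.mono {A : Type*} [CommRing A] {I J : Ideal A} (h : IsRegularIdeal I)
    (hIJ : I ≤ J) : IsRegularIdeal J :=
  let ⟨a, ha, har⟩ := h
  ⟨a, hIJ ha, har⟩

/-- A regular ideal that is not contained in the unique regular maximal ideal is the whole ring. -/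
theorem IsUniqueRegularMaximal.eq_top_of_not_le {A : Type*} [CommRing A] {m : Ideal A}
    (hm : IsUniqueRegularMaximal m) {I : Ideal A} (hI : IsRegularIdeal I) (hIm : ¬ I ≤ m) :
    I = ⊤ := by
  by_contra h
  obtain ⟨n, hn, hIn⟩ := Ideal.exists_le_maximal I h
  exact hIm (hm.eq_of_isMaximal n hn (hI.mono hIn) ▸ hIn)

/-- In a Prüfer Manis ring, a fraction `a / s` that is not in the ring is carried by some `y ∈ m` to
an element outside `m`. -/
theorem IsPruferManisRing.dvd_or_exists_mul_eq {B : Type*} [CommRing B] {m : Ideal B}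
    (hB : IsPruferManisRing B m) (a : B) {s : B} (hs : s ∈ B⁰) :
    s ∣ a ∨ ∃ y ∈ m, ∃ z, z ∉ m ∧ a * y = s * z := by
  have hinj := IsFractionRing.injective B (FractionRing B)
  obtain ⟨J, hJ⟩ := hB.isPrufer (Ideal.span {a, s}) (Submodule.fg_span (Set.toFinite _))
    ⟨s, Ideal.subset_span (by simp), hs⟩
  have hmem : ∀ b ∈ Ideal.span {a, s}, ∀ j ∈ J, ∃ c : B,
      algebraMap B (FractionRing B) c = algebraMap B _ b * j := fun b hb j hj =>
    Submodule.mem_one.1 (hJ ▸ Submodule.mul_mem_mul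
      ((IsLocalization.mem_coeSubmodule _ _).2 ⟨b, hb, rfl⟩) hj)
  have h1 : (1 : FractionRing B) ∈
      IsLocalization.coeSubmodule (FractionRing B) (Ideal.span {a, s}) * J :=
    hJ ▸ Submodule.one_le.1 le_rfl
  rw [IsLocalization.coeSubmodule_span, Set.image_pair, Submodule.span_insert, Submodule.sup_mul,
    Submodule.mem_sup] at h1
  obtain ⟨u, hu, v, hv, huv⟩ := h1
  obtain ⟨j, hj, rfl⟩ := Submodule.mem_span_singleton_mul.1 hu
  obtain ⟨k, hk, rfl⟩ := Submodule.mem_span_singleton_mul.1 hv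
  have ha : a ∈ Ideal.span {a, s} := Ideal.subset_span (by simp)
  have hs' : s ∈ Ideal.span {a, s} := Ideal.subset_span (by simp)
  obtain ⟨aj, haj⟩ := hmem a ha j hj
  obtain ⟨ak, hak⟩ := hmem a ha k hk
  obtain ⟨sj, hsj⟩ := hmem s hs' j hj
  obtain ⟨sk, hsk⟩ := hmem s hs' k hk
  have hone : aj + sk = 1 := hinj (by rw [map_add, haj, hsk, huv, map_one])
  have hj' : a * sj = s * aj := hinj (by rw [map_mul, map_mul, haj, hsj]; ring)
  have hk' : a * sk = s * ak := hinj (by rw [map_mul, map_mul, hak, hsk]; ring)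
  refine or_iff_not_imp_left.2 fun hdvd => ?_
  -- The ideal of denominators of `a / s` contains `s`, so it is regular; it is proper unless `s ∣
  -- a`. It contains `sj` and `sk`, so `aj = 1 - sk` lies outside `m`.
  have hle : Submodule.comap (LinearMap.mulLeft B a) (Ideal.span {s}) ≤ m := by
    by_contra hle
    refine hdvd ?_
    have htop := hB.isUniqueRegularMaximal.eq_top_of_not_le
      (I := Submodule.comap (LinearMap.mulLeft B a) (Ideal.span {s}))
      ⟨s, Ideal.mem_span_singleton.2 (Dvd.intro_left a rfl), hs⟩ hle
    have h : a * 1 ∈ Ideal.span {s} := (Ideal.eq_top_iff_one _).1 htop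
    rwa [mul_one, Ideal.mem_span_singleton] at h
  have hsjm : sj ∈ m := hle (Ideal.mem_span_singleton.2 ⟨aj, hj'⟩)
  have hskm : sk ∈ m := hle (Ideal.mem_span_singleton.2 ⟨ak, hk'⟩)
  refine ⟨sj, hsjm, aj, fun hajm => ?_, hj'⟩
  exact hB.isUniqueRegularMaximal.isMaximal.ne_top
    ((Ideal.eq_top_iff_one _).2 (hone ▸ m.add_mem hajm hskm))

/-- The Manis condition can be checked on numerators and denominators. -/
theorem IsManisPair.of_dvd_or_exists_mul_eq {A : Type*} [CommRing A] {p : Ideal A} (hp : p.IsPrime)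
    (h : ∀ a : A, ∀ s ∈ A⁰, s ∣ a ∨ ∃ y ∈ p, ∃ z, z ∉ p ∧ a * y = s * z) : IsManisPair A p where
  isPrime := hp
  exists_mul_eq x hx := by
    obtain ⟨a, s, rfl⟩ := IsLocalization.exists_mk'_eq A⁰ x
    have hu := IsLocalization.map_units (FractionRing A) s
    rcases h a s s.2 with ⟨b, rfl⟩ | ⟨y, hy, z, hz, hyz⟩
    · exact absurd ⟨b, by rw [IsLocalization.eq_mk'_iff_mul_eq, map_mul, mul_comm]⟩ hx
    · refine ⟨y, hy, z, hz, hu.mul_left_cancel ?_⟩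
      rw [← mul_assoc, IsLocalization.mk'_spec', ← map_mul, ← map_mul, hyz]

/-- A finite set of elements of a regular ideal `I` can be scaled into `A` in such a way that some
element of `I` is carried outside `p`. -/
theorem IsManisPair.exists_scaling {A : Type*} [CommRing A] {p : Ideal A} (h : IsManisPair A p)
    {I : Ideal A} (hI : IsRegularIdeal I) (S : Finset A) (hS : (S : Set A) ⊆ I) :
    ∃ j : FractionRing A, (∀ x ∈ S, ∃ b, algebraMap A (FractionRing A) b = algebraMap A _ x * j) ∧
      ∃ c ∈ I, ∃ z, z ∉ p ∧ algebraMap A (FractionRing A) z = algebraMap A _ c * j := by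
  classical
  induction S using Finset.induction_on with
  | empty =>
    obtain ⟨r, hr, hr0⟩ := hI
    refine ⟨IsLocalization.mk' _ 1 (⟨r, hr0⟩ : A⁰), by simp, r, hr, 1,
      (Ideal.ne_top_iff_one p).1 h.isPrime.ne_top, ?_⟩
    exact (IsLocalization.mk'_spec' (FractionRing A) 1 (⟨r, hr0⟩ : A⁰)).symm
  | insert x S _ ih =>
    rw [Finset.coe_insert, Set.insert_subset_iff] at hS
    obtain ⟨j, hj, hc⟩ := ih hS.2
    -- If `x * j` is not in `A`, rescaling `j` by the Manis element `y` keeps the earlier products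
    -- in `A` and makes `x` the new witness.
    by_cases hx : algebraMap A (FractionRing A) x * j ∈ Set.range (algebraMap A (FractionRing A))
    · exact ⟨j, by simpa using ⟨hx, hj⟩, hc⟩
    · obtain ⟨y, -, z, hz, hyz⟩ := h.exists_mul_eq _ hx
      refine ⟨j * algebraMap A _ y, ?_, x, hS.1, z, hz, by rw [← hyz, mul_assoc]⟩
      rintro w hw
      rcases Finset.mem_insert.1 hw with rfl | hw
      · exact ⟨z, by rw [← hyz, mul_assoc]⟩
      · obtain ⟨b, hb⟩ := hj w hw
        exact ⟨b * y, by rw [map_mul, hb, mul_assoc]⟩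

/-- If `(A, p)` is a Manis pair and every regular ideal outside `p` is the whole ring, then `A` is
a Prüfer ring. -/
theorem IsManisPair.isPruferRing {A : Type*} [CommRing A] {p : Ideal A} (h : IsManisPair A p)
    (htop : ∀ I : Ideal A, IsRegularIdeal I → ¬ I ≤ p → I = ⊤) : IsPruferRing A := by
  rintro I ⟨S, rfl⟩ hI
  obtain ⟨j, hj, c, hc, z, hz, hcz⟩ := h.exists_scaling hI S Ideal.subset_span
  set C := IsLocalization.coeSubmodule (FractionRing A) (Ideal.span (S : Set A)) with hC
  have hjC : j ∈ 1 / C := by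
    rw [hC, IsLocalization.coeSubmodule_span, Submodule.mem_div_iff_forall_mul_mem]
    intro x hx
    induction hx using Submodule.span_induction with
    | mem x hx =>
      obtain ⟨s, hs, rfl⟩ := hx
      rw [mul_comm]
      exact Submodule.mem_one.2 (hj s hs)
    | zero => simp
    | add x y _ _ hx hy => rw [mul_add]; exact add_mem hx hy
    | smul a x _ hx => rw [mul_smul_comm]; exact Submodule.smul_mem _ a hx
  have h1C : (1 : FractionRing A) ∈ 1 / C := by
    rw [Submodule.mem_div_iff_forall_mul_mem]
    intro x hx
    obtain ⟨a, -, rfl⟩ := (IsLocalization.mem_coeSubmodule _ _).1 hx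
    exact Submodule.mem_one.2 ⟨a, (one_mul _).symm⟩
  refine ⟨1 / C, le_antisymm Submodule.mul_one_div_le_one (Submodule.one_le.2 ?_)⟩
  have hmul : ∀ a ∈ Ideal.span (S : Set A), ∀ k ∈ 1 / C,
      algebraMap A (FractionRing A) a * k ∈ C * (1 / C) := fun a ha k hk =>
    Submodule.mul_mem_mul ((IsLocalization.mem_coeSubmodule _ _).2 ⟨a, ha, rfl⟩) hk
  -- This ideal is regular because `1 ∈ 1 / C` puts `I` inside it, and it escapes `p` because `j ∈ 1
  -- / C` puts `z` inside it.
  have hT := htop ((C * (1 / C)).comap (Algebra.linearMap A (FractionRing A))) ?_ ?_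
  · have h1 : algebraMap A (FractionRing A) 1 ∈ C * (1 / C) := (Ideal.eq_top_iff_one _).1 hT
    rwa [map_one] at h1
  · obtain ⟨r, hr, hr0⟩ := hI
    have hr1 := hmul r hr 1 h1C
    rw [mul_one] at hr1
    exact ⟨r, hr1, hr0⟩
  · refine fun hle => hz (hle ?_)
    change algebraMap A (FractionRing A) z ∈ C * (1 / C)
    rw [hcz]
    exact hmul c hc j hjC

/-- An element of `A⁰` remains a non-zero-divisor in an overring `B` if `A` contains a regular
element of `B` that multiplies `B` into `A`. -/
theorem Subring.coe_mem_nonZeroDivisors_of_mul_mem {B : Type*} [CommRing B] {A : Subring B} {t : B}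
    (ht : t ∈ B⁰) (htA : ∀ b, t * b ∈ A) {s : A} (hs : s ∈ A⁰) : (s : B) ∈ B⁰ := by
  rw [mem_nonZeroDivisors_iff_right] at hs ⊢
  intro b hb
  have h := hs ⟨t * b, htA b⟩ (Subtype.ext (by simp [mul_assoc, hb]))
  exact (mul_left_mem_nonZeroDivisors_eq_zero_iff ht).1 (congrArg Subtype.val h)

theorem mainTheorem10 {B : Type*} [CommRing B] (m : Ideal B) (hB : IsPruferManisRing B m)
    (V : Subring (B ⧸ m)) [IsDomain V] [ValuationRing V] [IsFractionRing V (B ⧸ m)] :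
    ∃ p : Ideal (V.comap (Ideal.Quotient.mk m)),
      IsPruferManisRing (V.comap (Ideal.Quotient.mk m)) p ∧
        IsManisPair (V.comap (Ideal.Quotient.mk m)) p := by
  have hm := hB.isUniqueRegularMaximal
  have hmax := hm.isMaximal
  obtain ⟨t, htm, ht⟩ := hm.isRegular
  set π := Ideal.Quotient.mk m with hπ
  have hπ0 : ∀ {b}, π b = 0 ↔ b ∈ m := Ideal.Quotient.eq_zero_iff_mem
  have hsurj : Function.Surjective π := Ideal.Quotient.mk_surjective
  set A := V.comap π with hA
  have hmA : ∀ b ∈ m, b ∈ A := fun b hb => by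
    rw [hA, Subring.mem_comap, hπ0.2 hb]; exact V.zero_mem
  have hreg : ∀ {s : A}, s ∈ A⁰ → (s : B) ∈ B⁰ :=
    Subring.coe_mem_nonZeroDivisors_of_mul_mem ht fun b => hmA _ (m.mul_mem_right b htm)
  let ρ : A →+* V := (π.comp A.subtype).codRestrict V fun a => a.2
  have hρ : ∀ a : A, (ρ a : B ⧸ m) = π a := fun _ => rfl
  have hρsurj : Function.Surjective ρ := fun v => by
    obtain ⟨b, hb⟩ := hsurj v
    exact ⟨⟨b, by rw [hA, Subring.mem_comap, hb]; exact v.2⟩, Subtype.ext hb⟩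
  let p : Ideal A := (IsLocalRing.maximalIdeal V).comap ρ
  have hpmax : p.IsMaximal := Ideal.comap_isMaximal_of_surjective ρ hρsurj
  have hmp : ∀ {a : A}, (a : B) ∈ m → a ∈ p := fun {a} ha => by
    have : ρ a = 0 := Subtype.ext (hπ0.2 ha)
    rw [Ideal.mem_comap, this]; exact zero_mem _
  have hmem_p : ∀ {a : A}, a ∈ p ↔ ¬ IsUnit (ρ a) := Iff.rfl
  -- the inverse modulo `m` of an element outside `m`
  have hinv : ∀ b ∉ m, ∃ w, π b * π w = 1 := fun b hb => by
    let _ := Ideal.Quotient.field m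
    obtain ⟨w, hw⟩ := hsurj (π b)⁻¹
    exact ⟨w, by rw [hw]; exact mul_inv_cancel₀ (mt hπ0.1 hb)⟩
  have hval : ∀ x w : B ⧸ m, x * w = 1 → x ∈ V ∨ w ∈ V := fun x w hxw => by
    let _ := Ideal.Quotient.field m
    rw [eq_inv_of_mul_eq_one_right hxw]
    exact (ValuationRing.isInteger_or_isInteger V x).imp (fun ⟨v, hv⟩ => hv ▸ v.2)
      fun ⟨v, hv⟩ => hv ▸ v.2
  have hone : ∀ {b : B}, π b = 1 → ∃ z : A, z ∉ p ∧ (z : B) = b := fun {b} hb => by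
    have hbA : b ∈ A := by rw [hA, Subring.mem_comap, hb]; exact V.one_mem
    have hρb : ρ ⟨b, hbA⟩ = 1 := Subtype.ext hb
    exact ⟨⟨b, hbA⟩, fun h => hmem_p.1 h (hρb ▸ isUnit_one), rfl⟩
  -- a regular ideal not contained in `p` is the whole ring
  have htop : ∀ I : Ideal A, IsRegularIdeal I → ¬ I ≤ p → I = ⊤ := by
    rintro I ⟨s, hsI, hs⟩ hIp
    obtain ⟨b, hbI, hbp⟩ := SetLike.not_le_iff_exists.1 hIp
    -- With `s * t` in place of `s`, the coefficient of `s` in the resulting relation is `c * t ∈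
    -- m`, hence in `A`; the coefficient of `b` is in `A` because it inverts a unit of `V` modulo
    -- `m`.
    have hT := hm.eq_top_of_not_le (I := Ideal.span {(b : B), (s : B) * t})
      ⟨s * t, Ideal.subset_span (by simp), mul_mem (hreg hs) ht⟩
      fun hle => hbp (hmp (hle (Ideal.subset_span (by simp))))
    obtain ⟨b', c, hbc⟩ := Ideal.mem_span_pair.1 ((Ideal.eq_top_iff_one _).1 hT)
    obtain ⟨u, hu⟩ := not_not.1 (mt hmem_p.2 hbp)
    have hb' : π b' = ((u⁻¹ : Vˣ) : V) := by
      have h1 : π b' * π b = 1 := by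
        rw [← map_one π, ← hbc, map_add, map_mul, hπ0.2 (m.mul_mem_left c (m.mul_mem_left _ htm)),
          add_zero]
      have h2 : π b * ((u⁻¹ : Vˣ) : V) = 1 := by
        rw [← hρ, ← hu]
        exact congrArg Subtype.val u.mul_inv
      exact left_inv_eq_right_inv h1 h2
    rw [Ideal.eq_top_iff_one]
    have : (1 : A) = ⟨b', by rw [hA, Subring.mem_comap, hb']; exact Subtype.property _⟩ * b +
        ⟨c * t, hmA _ (m.mul_mem_left c htm)⟩ * s := Subtype.ext (by
      simp only [Subring.coe_one, Subring.coe_add, Subring.coe_mul]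
      rw [← hbc]; ring)
    rw [this]
    exact I.add_mem (I.mul_mem_left _ hbI) (I.mul_mem_left _ hsI)
  have hManis : IsManisPair A p := by
    refine .of_dvd_or_exists_mul_eq hpmax.isPrime fun a s hs => ?_
    rcases hB.dvd_or_exists_mul_eq (a : B) (hreg hs) with ⟨x, hx⟩ | ⟨y, hy, z, hz, hyz⟩
    · by_cases hxA : x ∈ A
      · exact .inl ⟨⟨x, hxA⟩, Subtype.ext hx⟩
      right
      -- The Manis element is a lift `w` of the inverse of `π x`: it lies in `p`, since otherwise `π
      -- x` would be in `V`.
      obtain ⟨w, hw⟩ := hinv x fun h => hxA (hmA x h)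
      have hwV : π w ∈ V := (hval _ _ hw).resolve_left hxA
      obtain ⟨z, hzp, hz⟩ := hone (b := x * w) (by rw [map_mul, hw])
      refine ⟨⟨w, hwV⟩, fun hu => ?_, z, hzp, Subtype.ext ?_⟩
      · obtain ⟨v, hv⟩ := IsUnit.exists_left_inv hu
        have hxv : π x = v := (left_inv_eq_right_inv (a := π w) (congrArg Subtype.val hv)
          (by rw [mul_comm, hw])).symm
        exact hxA (by rw [hA, Subring.mem_comap, hxv]; exact v.2)
      · simp only [Subring.coe_mul]
        rw [hx, hz]; ring
    · right
      -- Being outside `m` does not put `z` in `A`, so `z` is normalised to `1` modulo `m`; `y * w`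
      -- stays in `m`.
      obtain ⟨w, hw⟩ := hinv z hz
      obtain ⟨z', hzp, hz'⟩ := hone (b := z * w) (by rw [map_mul, hw])
      refine ⟨⟨y * w, hmA _ (m.mul_mem_right w hy)⟩, hmp (m.mul_mem_right w hy), z', hzp,
        Subtype.ext ?_⟩
      simp only [Subring.coe_mul]
      rw [hz', ← mul_assoc, hyz, mul_assoc]
  refine ⟨p, ⟨hManis.isPruferRing htop, hpmax, ?_, fun n hn hnr => ?_⟩, hManis⟩
  · refine ⟨⟨t, hmA t htm⟩, hmp htm, ?_⟩
    rw [mem_nonZeroDivisors_iff_right]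
    intro x hx
    exact Subtype.ext ((mem_nonZeroDivisors_iff_right.1 ht) x (congrArg Subtype.val hx))
  · exact hn.eq_of_le hpmax.ne_top (not_not.1 fun h => hn.ne_top (htop n hnr h))
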